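/- Let $(R,\mathfrak m)$ be a $3$-dimensional Cohen-Macaulay (Noetherian) local ring, let $x,y,z$ be a system of parameters for $R$, and let $\alpha,\beta,\gamma,\alpha',\beta',\gamma'$ be positive integers. Let $I$ be the ideal of $R$ generated by the maximal minors of the matrix $$\begin{pmatrix} x^{\alpha} & y^{\beta} & z^{\gamma} \\ y^{\beta'} & z^{\gamma'} & x^{\alpha'} \end{pmatrix},$$ and put $\alpha''=\min\{\alpha,\alpha'\}$, $\beta''=\min\{\beta,\beta'\}$, $\gamma''=\min\{\gamma,\gamma'\}$ and $Q=(x^{\alpha''},y^{\beta''},z^{\gamma''})R$. Let $I^{(2)}=\bigcap_{\mathfrak p}\,(I^2R_{\mathfrak p}\cap R)$ be the second symbolic power of $I$, where $\mathfrak p$ runs over the minimal primes of $R/I$ (that is, the primes minimal over $I$) and $I^2R_{\mathfrak p}\cap R$ denotes the preimage of $I^2R_{\mathfrak p}$ under $R\to R_{\mathfrak p}$. Then $$I^{(2)}=I^2:_R Q:=\{r\in R\mid rQ\subseteq I^2\} \qquad\text{and}\qquad I^{(2)}/I^2\cong R/Q \text{ as } R\text{-modules}.$$ -/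

import Mathlib

/-- A Noetherian local ring is Cohen-Macaulay if its maximal ideal contains a regular sequence
(on the ring itself) whose length is the Krull dimension, that is, if `depth R = dim R`. -/
def IsCohenMacaulayLocal (R : Type*) [CommRing R] [IsLocalRing R] [IsNoetherianRing R] : Prop :=
  ∃ rs : List R, (∀ r ∈ rs, r ∈ IsLocalRing.maximalIdeal R) ∧
    RingTheory.Sequence.IsRegular R rs ∧ (rs.length : WithBot ℕ∞) = ringKrullDim R

/-- A system of parameters of a local ring: `d = dim R` elements that generate an ideal which is
primary to the maximal ideal. -/
def IsSystemOfParameters {R : Type*} [CommRing R] [IsLocalRing R] {d : ℕ} (x : Fin d → R) : Prop :=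
  (d : WithBot ℕ∞) = ringKrullDim R ∧
    (Ideal.span (Set.range x)).radical = IsLocalRing.maximalIdeal R

/-- The ideal generated by the maximal minors of an `m × n` matrix (for `m ≤ n`): one minor for
every increasing choice of `m` columns. -/
def maximalMinorsIdeal {R : Type*} [CommRing R] {m n : ℕ} (A : Matrix (Fin m) (Fin n) R) :
    Ideal R :=
  Ideal.span (Set.range fun e : Fin m ↪o Fin n => (A.submatrix id e).det)

/-- The `n`-th symbolic power `⋂ (Iⁿ R_𝔭 ∩ R)`, the intersection being over the minimal
primes `𝔭` of `I`. -/
def symbolicPower {R : Type*} [CommRing R] (I : Ideal R) (n : ℕ) : Ideal R :=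
  ⨅ (p : PrimeSpectrum R) (_ : p.asIdeal ∈ I.minimalPrimes),
    ((I ^ n).map (algebraMap R (Localization.AtPrime p.asIdeal))).comap
      (algebraMap R (Localization.AtPrime p.asIdeal))

/-- The ordinary power lies in the symbolic power, so that the quotient makes sense. -/
theorem pow_le_symbolicPower {R : Type*} [CommRing R] (I : Ideal R) (n : ℕ) :
    I ^ n ≤ symbolicPower I n :=
  le_iInf fun _ => le_iInf fun _ => Ideal.le_comap_map

/-- The `R`-module `I⁽ⁿ⁾ / Iⁿ`. -/
abbrev SymbolicPowerQuotient {R : Type*} [CommRing R] (I : Ideal R) (n : ℕ) : Type _ :=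
  symbolicPower I n ⧸ (I ^ n).submoduleOf (symbolicPower I n)

/-! Let $u, v$ be the rows of the matrix, $f_i$ the minors, $U=\sum u_iT_i$ and $V=\sum v_iT_i$. The
degree-two part of the Koszul complex on $U, V$, continued by $T_i\mapsto f_i$, is a resolution
$0\to R\to R^6\to R^6\to R$ of $R/I^2$ (`isExactComplex`). The entries of its leftmost map are $\pm
u_i, \pm v_i$, and these generate $Q$.

For a regular sequence $p=(p_1,p_2,p_3)$, comparing the Koszul complex of $p$ with this resolution
identifies $(I^2:(p))/I^2$ with $((p):Q)/(p)$ (`KoszulLift`). For $p=q$, the given generators of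
$Q$, this is $R/Q$; let $d$ correspond to $1$, so that $sd\in I^2$ iff $s\in Q$. For
$p=(q_1^{n+1},q_2^{n+1},q_3^{n+1})$ the colon $(p):Q$ is generated over $(p)$ by $(q_1q_2q_3)^n$
(`exists_eq_of_mul_mem_pow`), which is exactly the class of the same $d$. So $d$ generates every
$I^2:(p)$ modulo $I^2$.

A prime containing $I$ and $x$ is maximal, so $\dim R/I\le 1$; and $x$ is regular modulo $I$, so
$\mathfrak m$ is not minimal over $I$. Hence each element of $I^{(2)}$ lies in some $I^2:(p)$, while
$Q$ lies in no minimal prime of $I$. Cohen-Macaulayness is used to make every system of parameters,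
in any order, a regular sequence. -/

namespace CohenMacaulayTools

universe u

open RingTheory.Sequence IsLocalRing CategoryTheory Abelian Limits Pointwise

/-! ### Depth, and systems of parameters as regular sequences. -/

/-- If `a` is regular on a finite module `M`, then every associated prime of `M` is strictly
contained in an associated prime of `M / a M`. -/
theorem exists_lt_isAssociatedPrime_quotSMulTop {R : Type u} [CommRing R] [IsLocalRing R]
    [IsNoetherianRing R] {M : Type u} [AddCommGroup M] [Module R M] [Module.Finite R M]
    {p : Ideal R} (hp : IsAssociatedPrime p M) {a : R} (ham : a ∈ maximalIdeal R)
    (ha : IsSMulRegular M a) :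
    ∃ P : Ideal R, IsAssociatedPrime P (QuotSMulTop a M) ∧ p ≤ P ∧ a ∈ P ∧ a ∉ p := by
  obtain ⟨hpp, m₀, hm₀⟩ := isAssociatedPrime_iff.mp hp
  have hm₀' : m₀ ≠ 0 := by
    rintro rfl
    exact hpp.ne_top (by rw [hm₀]; ext; simp [Submodule.mem_colon_singleton])
  have ha0 : ∀ m : M, a • m = 0 → m = 0 := fun m hm ↦ ha (by simpa using hm)
  let N : Submodule R M := Submodule.torsionBySet R M p
  have hN : ∀ m, m ∈ N ↔ ∀ r ∈ p, r • m = 0 := fun m ↦ by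
    simp [N, Submodule.mem_torsionBySet_iff]
  have hmN : m₀ ∈ N := (hN _).2 fun r hr ↦ by
    rw [hm₀, Submodule.mem_colon_singleton] at hr
    simpa using hr
  -- Nakayama gives `m` in `N` outside `a N`. It is then outside `a M` too: if `m = a • m'`,
  -- regularity of `a` puts `m'` in `N`. The class of `m` is killed by both `p` and `a`.
  have hne : ∃ m ∈ N, ∀ m' ∈ N, a • m' ≠ m := by
    by_contra! hcon
    have hle : N ≤ Ideal.span {a} • N := fun m hm ↦ by
      obtain ⟨m', hm', rfl⟩ := hcon m hm
      exact Submodule.smul_mem_smul (Ideal.mem_span_singleton_self a) hm'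
    have hbot : N = ⊥ := Submodule.eq_bot_of_le_smul_of_le_jacobson_bot (Ideal.span {a}) N
      (IsNoetherian.noetherian N) hle (by
        rw [Ideal.span_singleton_le_iff_mem]
        exact maximalIdeal_le_jacobson _ ham)
    exact hm₀' (by simpa [hbot] using hmN)
  obtain ⟨m, hm, hma⟩ := hne
  have hmk : (Submodule.Quotient.mk m : QuotSMulTop a M) ≠ 0 := by
    rw [Ne, Submodule.Quotient.mk_eq_zero, Submodule.mem_smul_pointwise_iff_exists]
    rintro ⟨m', -, rfl⟩
    refine hma m' ((hN _).2 fun r hr ↦ ha0 _ ?_) rfl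
    rw [smul_comm]
    exact (hN _).1 hm r hr
  obtain ⟨P, hP, hle⟩ := exists_le_isAssociatedPrime_of_isNoetherianRing R _ hmk
  refine ⟨P, hP, fun r hr ↦ hle ?_, hle ?_, fun hap ↦ hm₀' (ha0 _ ((hN _).1 hmN a hap))⟩
  · rw [Submodule.mem_colon_singleton, ← Submodule.Quotient.mk_smul, (hN _).1 hm r hr]
    simp
  · rw [Submodule.mem_colon_singleton, ← Submodule.Quotient.mk_smul, Submodule.mem_bot,
      Submodule.Quotient.mk_eq_zero]
    exact Submodule.smul_mem_pointwise_smul _ _ _ Submodule.mem_top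

theorem ringKrullDim_quotient_succ_le_of_lt {R : Type u} [CommRing R] {p P : Ideal R}
    (hp : p.IsPrime) (hle : p ≤ P) {a : R} (ha : a ∈ P) (hap : a ∉ p) :
    ringKrullDim (R ⧸ P) + 1 ≤ ringKrullDim (R ⧸ p) := by
  refine ringKrullDim_succ_le_of_surjective (Ideal.Quotient.factor hle)
    (Ideal.Quotient.factor_surjective hle) (r := Ideal.Quotient.mk p a) ?_ ?_
  · refine mem_nonZeroDivisors_of_ne_zero ?_
    rwa [Ne, Ideal.Quotient.eq_zero_iff_mem]
  · simpa [Ideal.Quotient.eq_zero_iff_mem] using ha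

/-- The length of a regular sequence on `M` is at most `dim R / p`, for every associated
prime `p` of `M`. -/
theorem length_le_ringKrullDim_quotient_of_isAssociatedPrime {R : Type u} [CommRing R]
    [IsLocalRing R] [IsNoetherianRing R] (rs : List R) {M : Type u} [AddCommGroup M] [Module R M]
    [Module.Finite R M] (hmem : ∀ r ∈ rs, r ∈ maximalIdeal R) (hreg : IsRegular M rs)
    {p : Ideal R} (hp : IsAssociatedPrime p M) :
    (rs.length : WithBot ℕ∞) ≤ ringKrullDim (R ⧸ p) := by
  induction rs generalizing M p with
  | nil =>
    have : Nontrivial (R ⧸ p) := Ideal.Quotient.nontrivial_iff.mpr hp.isPrime.ne_top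
    simpa using ringKrullDim_nonneg_of_nontrivial
  | cons a rs ih =>
    rw [isRegular_cons_iff] at hreg
    simp only [List.mem_cons, forall_eq_or_imp] at hmem
    obtain ⟨P, hP, hle, haP, hap⟩ := exists_lt_isAssociatedPrime_quotSMulTop hp hmem.1 hreg.1
    refine le_trans ?_ (ringKrullDim_quotient_succ_le_of_lt hp.isPrime hle haP hap)
    rw [List.length_cons, Nat.cast_add, Nat.cast_one]
    gcongr
    exact ih hmem.2 hreg.2 hP

/-- Krull's height theorem in `R ⧸ p`, whose maximal ideal is minimal over the images of `ys`. -/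
theorem ringKrullDim_quotient_le_length {R : Type u} [CommRing R] [IsLocalRing R]
    [IsNoetherianRing R] {p : Ideal R} (hp : p.IsPrime) (ys : List R)
    (hmem : ∀ y ∈ ys, y ∈ maximalIdeal R)
    (h : ∀ P : Ideal R, P.IsPrime → p ≤ P → (∀ y ∈ ys, y ∈ P) → P = maximalIdeal R) :
    ringKrullDim (R ⧸ p) ≤ ys.length := by
  classical
  have : Nontrivial (R ⧸ p) := Ideal.Quotient.nontrivial_iff.mpr hp.ne_top
  have : IsLocalRing (R ⧸ p) :=
    .of_surjective' (Ideal.Quotient.mk p) Ideal.Quotient.mk_surjective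
  have hmap : ∀ {y}, y ∈ maximalIdeal R → Ideal.Quotient.mk p y ∈ maximalIdeal (R ⧸ p) :=
    fun {y} hy ↦ by
      rw [mem_maximalIdeal, mem_nonunits_iff]
      intro hu
      have : IsLocalHom (Ideal.Quotient.mk p) :=
        .of_surjective _ Ideal.Quotient.mk_surjective
      exact hy (isUnit_of_map_unit (Ideal.Quotient.mk p) _ hu)
  set s : Finset (R ⧸ p) := (ys.map (Ideal.Quotient.mk p)).toFinset with hs
  have hmin : maximalIdeal (R ⧸ p) ∈ (Ideal.span (s : Set (R ⧸ p))).minimalPrimes := by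
    refine ⟨⟨inferInstance, Ideal.span_le.mpr fun y hy ↦ ?_⟩, fun J hJ _ ↦ ?_⟩
    · simp only [hs, List.coe_toFinset, List.mem_map, Set.mem_ofPred_eq] at hy
      obtain ⟨y, hy, rfl⟩ := hy
      exact hmap (hmem y hy)
    · have := hJ.1
      have hc : J.comap (Ideal.Quotient.mk p) = maximalIdeal R := by
        refine h _ inferInstance (fun r hr ↦ ?_) fun y hy ↦ ?_
        · rw [Ideal.mem_comap, Ideal.Quotient.eq_zero_iff_mem.mpr hr]
          exact J.zero_mem
        · exact hJ.2 (Ideal.subset_span (by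
            simpa [hs] using ⟨y, hy, rfl⟩))
      intro z hz
      obtain ⟨z, rfl⟩ := Ideal.Quotient.mk_surjective z
      rw [← Ideal.mem_comap, hc]
      by_contra hzu
      rw [mem_maximalIdeal, mem_nonunits_iff, not_not] at hzu
      exact hz (hzu.map _)
  rw [← maximalIdeal_height_eq_ringKrullDim]
  have h1 := Ideal.height_le_card_of_mem_minimalPrimes_span_finset hmin
  have h2 : s.card ≤ ys.length := (List.toFinset_card_le _).trans (by simp)
  exact_mod_cast h1.trans (Nat.cast_le.mpr h2)

/-- Dividing by a regular element lowers the depth by at most one. -/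
theorem exists_isRegular_quotSMulTop {R : Type u} [CommRing R] [IsLocalRing R]
    [IsNoetherianRing R] {M : Type u} [AddCommGroup M] [Module R M] [Module.Finite R M]
    {n : ℕ} (h : ∃ rs : List R, rs.length = n + 1 ∧ (∀ r ∈ rs, r ∈ maximalIdeal R) ∧
      IsRegular M rs)
    {x : R} (hxm : x ∈ maximalIdeal R) (hx : IsSMulRegular M x) :
    ∃ rs : List R, rs.length = n ∧ (∀ r ∈ rs, r ∈ maximalIdeal R) ∧
      IsRegular (QuotSMulTop x M) rs := by
  obtain ⟨rs, hlen, hmem, hreg⟩ := h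
  have : Nontrivial M := hreg.nontrivial
  have : Nontrivial (QuotSMulTop x M) := nontrivial_quotSMulTop_of_mem_maximalIdeal _ hxm
  have hlt : ∀ (L : Type u) [AddCommGroup L] [Module R L] [Module.Finite R L] [Nontrivial L],
      maximalIdeal R • (⊤ : Submodule R L) < ⊤ := fun L _ _ _ _ ↦
    (Submodule.top_ne_ideal_smul_of_le_jacobson_annihilator
      (maximalIdeal_le_jacobson _)).symm.lt_top
  let N : ModuleCat.{u} R := ModuleCat.of R (R ⧸ maximalIdeal R)
  have hsupp : Module.support R N = PrimeSpectrum.zeroLocus (maximalIdeal R) := by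
    change Module.support R (R ⧸ maximalIdeal R) = _
    rw [Module.support_eq_zeroLocus, Ideal.annihilator_quotient]
  -- Depth is read off from the vanishing of $\mathrm{Ext}^i(R/\mathfrak m,-)$: in the long exact
  -- sequence of multiplication by $x$, $\mathrm{Ext}^i(M/xM)$ sits between $\mathrm{Ext}^i(M)$ and
  -- $\mathrm{Ext}^{i+1}(M)$.
  have hext := ModuleCat.subsingleton_ext_of_exists_isRegular (maximalIdeal R) N hsupp.subset
    (ModuleCat.of R M) (hlt M) rs hmem hreg
  refine ModuleCat.exists_isRegular_of_exists_subsingleton_ext (maximalIdeal R) n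
    (ModuleCat.of R (QuotSMulTop x M)) (hlt _) N hsupp fun i hi ↦ ?_
  have hx' : IsSMulRegular (ModuleCat.of R M) x := hx
  have zero1 := AddCommGrpCat.isZero_of_iff_subsingleton.mpr (hext i (by omega))
  have zero2 := AddCommGrpCat.isZero_of_iff_subsingleton.mpr (hext (i + 1) (by omega))
  exact AddCommGrpCat.subsingleton_of_isZero <| ShortComplex.Exact.isZero_of_both_zeros
    ((Ext.covariant_sequence_exact₃' N hx'.smulShortComplex_shortExact) i (i + 1) rfl)
    (zero1.eq_zero_of_src _) (zero2.eq_zero_of_tgt _)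

/-- On a module of depth at least `n`, any `n` elements that cut its support down to the
closed point form a regular sequence. -/
theorem isRegular_of_exists_isRegular {R : Type u} [CommRing R] [IsLocalRing R]
    [IsNoetherianRing R] (xs : List R) {M : Type u} [AddCommGroup M] [Module R M]
    [Module.Finite R M]
    (h : ∃ rs : List R, rs.length = xs.length ∧ (∀ r ∈ rs, r ∈ maximalIdeal R) ∧
      IsRegular M rs)
    (hmem : ∀ x ∈ xs, x ∈ maximalIdeal R)
    (hxs : ∀ P : Ideal R, P.IsPrime → Module.annihilator R M ≤ P → (∀ x ∈ xs, x ∈ P) →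
      P = maximalIdeal R) :
    IsRegular M xs := by
  induction xs generalizing M with
  | nil =>
    obtain ⟨rs, -, -, hreg⟩ := h
    have := hreg.nontrivial
    exact .nil R M
  | cons x xs ih =>
    simp only [List.mem_cons, forall_eq_or_imp] at hmem
    have hx : IsSMulRegular M x := by
      -- A zero divisor `x` lies in an associated prime `p`. Then `xs` alone cuts `V(p)` down to the
      -- closed point, so `dim R ⧸ p` is at most `xs.length`, below the length of the given regular
      -- sequence.
      by_contra hx
      have hx' : x ∈ ⋃ p ∈ associatedPrimes R M, (p : Set R) := by
        rw [biUnion_associatedPrimes_eq_compl_regular]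
        exact hx
      simp only [Set.mem_iUnion, SetLike.mem_coe, exists_prop] at hx'
      obtain ⟨p, hp, hxp⟩ := hx'
      obtain ⟨rs, hlen, hrs, hreg⟩ := h
      have h1 := length_le_ringKrullDim_quotient_of_isAssociatedPrime rs hrs hreg hp
      have hann : Module.annihilator R M ≤ p := by
        rw [← Submodule.annihilator_top]
        exact hp.annihilator_le
      have h2 := ringKrullDim_quotient_le_length hp.isPrime xs hmem.2 fun P hP hpP hP' ↦
        hxs P hP (hann.trans hpP) (by simpa using ⟨hpP hxp, hP'⟩)
      have h3 := h1.trans h2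
      rw [hlen, List.length_cons] at h3
      have : xs.length + 1 ≤ xs.length := by exact_mod_cast h3
      omega
    rw [isRegular_cons_iff]
    refine ⟨hx, ih (exists_isRegular_quotSMulTop h hmem.1 hx) hmem.2 fun P hP hann hP' ↦ ?_⟩
    refine hxs P hP (fun r hr ↦ hann ?_) ?_
    · rw [Module.mem_annihilator] at hr ⊢
      intro m
      obtain ⟨m, rfl⟩ := Submodule.Quotient.mk_surjective _ m
      rw [← Submodule.Quotient.mk_smul, hr, Submodule.Quotient.mk_zero]
    · simp only [List.mem_cons, forall_eq_or_imp]
      refine ⟨hann ?_, hP'⟩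
      rw [Module.mem_annihilator]
      intro m
      obtain ⟨m, rfl⟩ := Submodule.Quotient.mk_surjective _ m
      rw [← Submodule.Quotient.mk_smul, Submodule.Quotient.mk_eq_zero]
      exact Submodule.smul_mem_pointwise_smul _ _ _ Submodule.mem_top

/-- In a Cohen-Macaulay local ring of dimension `n`, any `n` elements that generate an ideal
primary to the maximal ideal form a regular sequence. -/
theorem _root_.IsCohenMacaulayLocal.isRegular {R : Type u} [CommRing R] [IsLocalRing R]
    [IsNoetherianRing R] (hCM : IsCohenMacaulayLocal R) (xs : List R)
    (hlen : (xs.length : WithBot ℕ∞) = ringKrullDim R)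
    (hmem : ∀ x ∈ xs, x ∈ maximalIdeal R)
    (hxs : ∀ P : Ideal R, P.IsPrime → (∀ x ∈ xs, x ∈ P) → P = maximalIdeal R) :
    IsRegular R xs := by
  obtain ⟨rs, hrs, hreg, hl⟩ := hCM
  refine isRegular_of_exists_isRegular xs ⟨rs, ?_, hrs, hreg⟩ hmem fun P hP _ ↦ hxs P hP
  exact_mod_cast hl.trans hlen.symm

/-- A regular sequence of length three, in terms of elements. -/
structure RegularTriple {R : Type*} [CommRing R] (a b c : R) : Prop where
  fst : ∀ r, a * r = 0 → r = 0
  snd : ∀ r s, b * r = a * s → ∃ t, r = a * t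
  trd : ∀ r s t, c * r = a * s + b * t → ∃ s' t', r = a * s' + b * t'

theorem _root_.RingTheory.Sequence.IsWeaklyRegular.regularTriple {R : Type*} [CommRing R]
    {a b c : R} (h : IsWeaklyRegular R [a, b, c]) : RegularTriple a b c where
  fst r hr := by
    have h0 := h.regular_mod_prev 0 (by simp)
    rw [isSMulRegular_quotient_iff_mem_of_smul_mem] at h0
    simpa using h0 r (by simpa using hr)
  snd r s hr := by
    have h1 := h.regular_mod_prev 1 (by simp)
    rw [isSMulRegular_quotient_iff_mem_of_smul_mem] at h1
    have := h1 r (by simp [Ideal.mem_span_singleton, hr])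
    simp only [List.take_succ_cons, List.take_zero, Ideal.ofList_singleton, smul_eq_mul,
      Ideal.mul_top, Ideal.mem_span_singleton] at this
    exact this
  trd r s t hr := by
    have h2 := h.regular_mod_prev 2 (by simp)
    rw [isSMulRegular_quotient_iff_mem_of_smul_mem] at h2
    have key : ∀ w : R, w ∈ Ideal.ofList [a, b] • (⊤ : Submodule R R) ↔
        ∃ s t, w = a * s + b * t := fun w ↦ by
      rw [smul_eq_mul, Ideal.mul_top, Ideal.ofList_cons, Ideal.ofList_singleton,
        Submodule.mem_sup]
      simp only [Ideal.mem_span_singleton']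
      constructor
      · rintro ⟨_, ⟨s, rfl⟩, _, ⟨t, rfl⟩, rfl⟩
        exact ⟨s, t, by ring⟩
      · rintro ⟨s, t, rfl⟩
        exact ⟨_, ⟨s, rfl⟩, _, ⟨t, rfl⟩, by ring⟩
    exact (key r).1 (h2 r ((key _).2 ⟨s, t, by simpa using hr⟩))

end CohenMacaulayTools

/-! ### Comparing a Koszul complex with a resolution of length three. -/

namespace CohenMacaulayTools

variable {R : Type*} [CommRing R]

namespace RegularTriple

variable {p₁ p₂ p₃ : R}

/-- Exactness of the Koszul complex of `p₁, p₂, p₃` with coefficients in `Rⁱ` at the cocycles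
of degree one. -/
theorem exists_eq_smul (hp : RegularTriple p₁ p₂ p₃) {ι : Type*} {x y z : ι → R}
    (h₃ : p₁ • y = p₂ • x) (h₂ : p₁ • z = p₃ • x) :
    ∃ e : ι → R, x = p₁ • e ∧ y = p₂ • e ∧ z = p₃ • e := by
  have key : ∀ i, ∃ e, x i = p₁ * e ∧ y i = p₂ * e ∧ z i = p₃ * e := fun i ↦ by
    have h₃ := congrFun h₃ i
    have h₂ := congrFun h₂ i
    simp only [Pi.smul_apply, smul_eq_mul] at h₃ h₂
    obtain ⟨e, he⟩ := hp.snd (x i) (y i) h₃.symm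
    refine ⟨e, he, ?_, ?_⟩
    · exact sub_eq_zero.1 (hp.fst _ (by rw [he] at h₃; linear_combination h₃))
    · exact sub_eq_zero.1 (hp.fst _ (by rw [he] at h₂; linear_combination h₂))
  choose e h1 h2 h3 using key
  exact ⟨e, funext h1, funext h2, funext h3⟩

/-- Exactness of the Koszul complex of `p₁, p₂, p₃` with coefficients in `Rⁱ` at the cocycles
of degree two. -/
theorem exists_eq_cross (hp : RegularTriple p₁ p₂ p₃) {ι : Type*} {x y z : ι → R}
    (h : p₁ • x + p₂ • y + p₃ • z = 0) :
    ∃ e₁ e₂ e₃ : ι → R, x = p₂ • e₃ - p₃ • e₂ ∧ y = p₃ • e₁ - p₁ • e₃ ∧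
      z = p₁ • e₂ - p₂ • e₁ := by
  have key : ∀ i, ∃ e₁ e₂ e₃ : R, x i = p₂ * e₃ - p₃ * e₂ ∧ y i = p₃ * e₁ - p₁ * e₃ ∧
      z i = p₁ * e₂ - p₂ * e₁ := fun i ↦ by
    have h := congrFun h i
    simp only [Pi.add_apply, Pi.smul_apply, smul_eq_mul, Pi.zero_apply] at h
    obtain ⟨s, t, hst⟩ := hp.trd (z i) (-x i) (-y i) (by linear_combination h)
    obtain ⟨e, he⟩ := hp.snd (y i + p₃ * t) (-(x i + p₃ * s)) (by
      rw [hst] at h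
      linear_combination h)
    refine ⟨-t, s, -e, ?_, by linear_combination he, by rw [hst]; ring⟩
    refine sub_eq_zero.1 (hp.fst _ ?_)
    rw [hst] at h
    linear_combination h - p₂ * he
  choose e₁ e₂ e₃ h1 h2 h3 using key
  exact ⟨e₁, e₂, e₃, funext h1, funext h2, funext h3⟩

end RegularTriple

section Resolution

variable {ι κ : Type*} (g : (ι → R) →ₗ[R] R) (h : (κ → R) →ₗ[R] ι → R) (k : R →ₗ[R] κ → R)

/-- Exactness of `0 → R → Rᵏ → Rⁱ → R`. -/
structure IsExactComplex : Prop where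
  g_h : ∀ b, g (h b) = 0
  exists_h : ∀ a, g a = 0 → ∃ b, h b = a
  h_k : ∀ c, h (k c) = 0
  exists_k : ∀ b, h b = 0 → ∃ c, k c = b
  k_inj : ∀ c, k c = 0 → c = 0

/-- `KoszulLift g h k p₁ p₂ p₃ r c` says that `r`, which multiplies `p₁, p₂, p₃` into the range
of `g`, represents the same element as `c` under the isomorphism
`Hom(R/p, R/im g) ≅ ker(k ⊗ R/p)` obtained by comparing the Koszul complex of `p` with the
complex `k, h, g`. -/
def KoszulLift (p₁ p₂ p₃ r c : R) : Prop :=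
  ∃ (a₁ a₂ a₃ : ι → R) (b₁ b₂ b₃ : κ → R),
    (p₁ * r = g a₁ ∧ p₂ * r = g a₂ ∧ p₃ * r = g a₃) ∧
    (p₂ • a₃ - p₃ • a₂ = h b₁ ∧ p₃ • a₁ - p₁ • a₃ = h b₂ ∧ p₁ • a₂ - p₂ • a₁ = h b₃) ∧
    p₁ • b₁ + p₂ • b₂ + p₃ • b₃ = k c

variable {g h k} {p₁ p₂ p₃ : R}

theorem KoszulLift.sub_mul {r c r' c' : R} (s : R) (H : KoszulLift g h k p₁ p₂ p₃ r c)
    (H' : KoszulLift g h k p₁ p₂ p₃ r' c') :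
    KoszulLift g h k p₁ p₂ p₃ (r - s * r') (c - s * c') := by
  obtain ⟨a₁, a₂, a₃, b₁, b₂, b₃, ⟨h1, h2, h3⟩, ⟨h4, h5, h6⟩, h7⟩ := H
  obtain ⟨a₁', a₂', a₃', b₁', b₂', b₃', ⟨h1', h2', h3'⟩, ⟨h4', h5', h6'⟩, h7'⟩ := H'
  refine ⟨a₁ - s • a₁', a₂ - s • a₂', a₃ - s • a₃', b₁ - s • b₁', b₂ - s • b₂', b₃ - s • b₃',
    ⟨?_, ?_, ?_⟩, ⟨?_, ?_, ?_⟩, ?_⟩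
  · rw [map_sub, map_smul, ← h1, ← h1', smul_eq_mul]; ring
  · rw [map_sub, map_smul, ← h2, ← h2', smul_eq_mul]; ring
  · rw [map_sub, map_smul, ← h3, ← h3', smul_eq_mul]; ring
  · rw [map_sub, map_smul, ← h4, ← h4']; module
  · rw [map_sub, map_smul, ← h5, ← h5']; module
  · rw [map_sub, map_smul, ← h6, ← h6']; module
  · rw [map_sub, ← smul_eq_mul, map_smul, ← h7, ← h7']; module

theorem KoszulLift.zero : KoszulLift g h k p₁ p₂ p₃ 0 0 :=
  ⟨0, 0, 0, 0, 0, 0, by simp, by simp, by simp⟩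

theorem KoszulLift.mul {r c : R} (s : R) (H : KoszulLift g h k p₁ p₂ p₃ r c) :
    KoszulLift g h k p₁ p₂ p₃ (s * r) (s * c) := by
  simpa using KoszulLift.zero.sub_mul (-s) H

/-- The diagonal map between the Koszul complexes of `p` and of `t p` is multiplication by `t₁ t₂
t₃` on the top term. -/
theorem KoszulLift.scale {r c : R} (t₁ t₂ t₃ : R) (H : KoszulLift g h k p₁ p₂ p₃ r c) :
    KoszulLift g h k (t₁ * p₁) (t₂ * p₂) (t₃ * p₃) r (t₁ * t₂ * t₃ * c) := by
  obtain ⟨a₁, a₂, a₃, b₁, b₂, b₃, ⟨h1, h2, h3⟩, ⟨h4, h5, h6⟩, h7⟩ := H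
  refine ⟨t₁ • a₁, t₂ • a₂, t₃ • a₃, (t₂ * t₃) • b₁, (t₃ * t₁) • b₂, (t₁ * t₂) • b₃,
    ⟨?_, ?_, ?_⟩, ⟨?_, ?_, ?_⟩, ?_⟩
  · rw [map_smul, ← h1, smul_eq_mul]; ring
  · rw [map_smul, ← h2, smul_eq_mul]; ring
  · rw [map_smul, ← h3, smul_eq_mul]; ring
  · rw [map_smul, ← h4]; module
  · rw [map_smul, ← h5]; module
  · rw [map_smul, ← h6]; module
  · rw [← smul_eq_mul (_ * _), map_smul, ← h7]; module

/-- Confines the class `c` to the colon of `(p₁, p₂, p₃)` by the entries of `k`. -/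
theorem KoszulLift.exists_mul_eq {r c : R} (H : KoszulLift g h k p₁ p₂ p₃ r c) (i : κ) :
    ∃ s₁ s₂ s₃, k 1 i * c = p₁ * s₁ + p₂ * s₂ + p₃ * s₃ := by
  obtain ⟨a₁, a₂, a₃, b₁, b₂, b₃, -, -, h7⟩ := H
  refine ⟨b₁ i, b₂ i, b₃ i, ?_⟩
  have h := congrFun h7 i
  rw [← mul_one c, ← smul_eq_mul, map_smul] at h
  simp only [Pi.add_apply, Pi.smul_apply, smul_eq_mul] at h
  rw [mul_comm, ← h]

namespace IsExactComplex

variable (E : IsExactComplex g h k)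
include E

theorem exists_koszulLift {r : R} {a₁ a₂ a₃ : ι → R} (h₁ : p₁ * r = g a₁) (h₂ : p₂ * r = g a₂)
    (h₃ : p₃ * r = g a₃) : ∃ c, KoszulLift g h k p₁ p₂ p₃ r c := by
  obtain ⟨b₁, hb₁⟩ := E.exists_h (p₂ • a₃ - p₃ • a₂) (by
    simp only [map_sub, map_smul, ← h₂, ← h₃, smul_eq_mul]; ring)
  obtain ⟨b₂, hb₂⟩ := E.exists_h (p₃ • a₁ - p₁ • a₃) (by
    simp only [map_sub, map_smul, ← h₁, ← h₃, smul_eq_mul]; ring)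
  obtain ⟨b₃, hb₃⟩ := E.exists_h (p₁ • a₂ - p₂ • a₁) (by
    simp only [map_sub, map_smul, ← h₁, ← h₂, smul_eq_mul]; ring)
  obtain ⟨c, hc⟩ := E.exists_k (p₁ • b₁ + p₂ • b₂ + p₃ • b₃) (by
    simp only [map_add, map_smul, hb₁, hb₂, hb₃]; module)
  exact ⟨c, a₁, a₂, a₃, b₁, b₂, b₃, ⟨h₁, h₂, h₃⟩, ⟨hb₁.symm, hb₂.symm, hb₃.symm⟩, hc.symm⟩

/-- Injectivity of `r ↦ c` modulo `im g`: once the class is trivial, exactness of the Koszul complex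
of `p` builds a null homotopy, ending in a preimage `e` of `r`. -/
theorem mem_range_of_koszulLift (hp : RegularTriple p₁ p₂ p₃) {r s₁ s₂ s₃ : R}
    (H : KoszulLift g h k p₁ p₂ p₃ r (p₁ * s₁ + p₂ * s₂ + p₃ * s₃)) : ∃ a, g a = r := by
  obtain ⟨a₁, a₂, a₃, b₁, b₂, b₃, ⟨h1, h2, h3⟩, ⟨h4, h5, h6⟩, h7⟩ := H
  obtain ⟨e₁, e₂, e₃, he₁, he₂, he₃⟩ := hp.exists_eq_cross
    (x := b₁ - k s₁) (y := b₂ - k s₂) (z := b₃ - k s₃) (by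
      simp only [map_add, ← smul_eq_mul, map_smul] at h7
      linear_combination (norm := module) h7)
  have hk := E.h_k
  have hb₁ : h b₁ = p₂ • h e₃ - p₃ • h e₂ := by
    rw [sub_eq_iff_eq_add.1 he₁]; simp [hk]
  have hb₂ : h b₂ = p₃ • h e₁ - p₁ • h e₃ := by
    rw [sub_eq_iff_eq_add.1 he₂]; simp [hk]
  have hb₃ : h b₃ = p₁ • h e₂ - p₂ • h e₁ := by
    rw [sub_eq_iff_eq_add.1 he₃]; simp [hk]
  obtain ⟨e, ha, -, -⟩ := hp.exists_eq_smul (x := a₁ - h e₁) (y := a₂ - h e₂) (z := a₃ - h e₃)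
    (by rw [hb₃] at h6; linear_combination (norm := module) h6)
    (by rw [hb₂] at h5; linear_combination (norm := module) -h5)
  refine ⟨e, sub_eq_zero.1 (hp.fst _ ?_)⟩
  rw [mul_sub, h1, ← smul_eq_mul, ← map_smul, ← ha, map_sub, E.g_h]
  simp

/-- The class does not depend on the chosen lifts: here exactness of the resolution, not of the
Koszul complex, builds the homotopy. -/
theorem exists_eq_of_koszulLift {r c : R} {a : ι → R} (ha : g a = r)
    (H : KoszulLift g h k p₁ p₂ p₃ r c) : ∃ s₁ s₂ s₃, c = p₁ * s₁ + p₂ * s₂ + p₃ * s₃ := by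
  obtain ⟨a₁, a₂, a₃, b₁, b₂, b₃, ⟨h1, h2, h3⟩, ⟨h4, h5, h6⟩, h7⟩ := H
  subst ha
  obtain ⟨e₁, he₁⟩ := E.exists_h (a₁ - p₁ • a) (by simp [← h1])
  obtain ⟨e₂, he₂⟩ := E.exists_h (a₂ - p₂ • a) (by simp [← h2])
  obtain ⟨e₃, he₃⟩ := E.exists_h (a₃ - p₃ • a) (by simp [← h3])
  obtain ⟨s₁, hs₁⟩ := E.exists_k (b₁ - (p₂ • e₃ - p₃ • e₂)) (by
    simp only [map_sub, map_smul, he₂, he₃, ← h4]; module)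
  obtain ⟨s₂, hs₂⟩ := E.exists_k (b₂ - (p₃ • e₁ - p₁ • e₃)) (by
    simp only [map_sub, map_smul, he₁, he₃, ← h5]; module)
  obtain ⟨s₃, hs₃⟩ := E.exists_k (b₃ - (p₁ • e₂ - p₂ • e₁)) (by
    simp only [map_sub, map_smul, he₁, he₂, ← h6]; module)
  refine ⟨s₁, s₂, s₃, sub_eq_zero.1 (E.k_inj _ ?_)⟩
  simp only [map_sub, map_add, ← smul_eq_mul, map_smul, hs₁, hs₂, hs₃, ← h7]
  module

/-- If the entries of the last map of the resolution lie in `(p₁, p₂, p₃)`, then `1` lifts. -/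
theorem exists_koszulLift_one (hp : RegularTriple p₁ p₂ p₃)
    (hk : ∀ i, ∃ s₁ s₂ s₃, k 1 i = p₁ * s₁ + p₂ * s₂ + p₃ * s₃) :
    ∃ r, KoszulLift g h k p₁ p₂ p₃ r 1 := by
  choose b₁ b₂ b₃ hb using hk
  have hb' : p₁ • b₁ + p₂ • b₂ + p₃ • b₃ = k 1 := by
    funext i
    simp [hb]
  obtain ⟨a₁, a₂, a₃, ha₁, ha₂, ha₃⟩ := hp.exists_eq_cross
    (x := h b₁) (y := h b₂) (z := h b₃) (by
      simp only [← map_smul, ← map_add, hb', E.h_k])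
  have hg := E.g_h
  have h2 := congrArg g ha₂
  have h3 := congrArg g ha₃
  simp only [hg, map_sub, map_smul, smul_eq_mul] at h2 h3
  obtain ⟨e, he₁, he₂, he₃⟩ := hp.exists_eq_smul (ι := Unit) (x := fun _ ↦ g a₁)
    (y := fun _ ↦ g a₂) (z := fun _ ↦ g a₃)
    (funext fun _ ↦ by simpa using (sub_eq_zero.1 h3.symm))
    (funext fun _ ↦ by simpa using (sub_eq_zero.1 h2.symm).symm)
  exact ⟨e (), a₁, a₂, a₃, b₁, b₂, b₃,
    ⟨(congrFun he₁ ()).symm, (congrFun he₂ ()).symm, (congrFun he₃ ()).symm⟩,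
    ⟨ha₁.symm, ha₂.symm, ha₃.symm⟩, hb'⟩

end IsExactComplex

end Resolution

/-- `(q₁ⁿ, q₂ⁿ, q₃ⁿ) : (q₁, q₂, q₃) = (q₁ⁿ, q₂ⁿ, q₃ⁿ, (q₁ q₂ q₃)ⁿ⁻¹)`, one inclusion. -/
theorem exists_eq_of_mul_mem_pow {q₁ q₂ q₃ : R} {n : ℕ}
    (h₁ : RegularTriple (q₂ ^ (n + 1)) (q₃ ^ (n + 1)) q₁)
    (h₁' : RegularTriple (q₂ ^ (n + 1)) (q₃ ^ (n + 1)) (q₁ ^ n))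
    (h₂ : RegularTriple q₁ (q₃ ^ (n + 1)) q₂)
    (h₂' : RegularTriple q₁ (q₃ ^ (n + 1)) (q₂ ^ n))
    (h₃ : RegularTriple q₁ q₂ q₃) {c : R}
    (hc₁ : ∃ s₁ s₂ s₃, q₁ * c = q₁ ^ (n + 1) * s₁ + q₂ ^ (n + 1) * s₂ + q₃ ^ (n + 1) * s₃)
    (hc₂ : ∃ s₁ s₂ s₃, q₂ * c = q₁ ^ (n + 1) * s₁ + q₂ ^ (n + 1) * s₂ + q₃ ^ (n + 1) * s₃)
    (hc₃ : ∃ s₁ s₂ s₃, q₃ * c = q₁ ^ (n + 1) * s₁ + q₂ ^ (n + 1) * s₂ + q₃ ^ (n + 1) * s₃) :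
    ∃ s s₁ s₂ s₃, c - s * (q₁ ^ n * q₂ ^ n * q₃ ^ n) =
      q₁ ^ (n + 1) * s₁ + q₂ ^ (n + 1) * s₂ + q₃ ^ (n + 1) * s₃ := by
  obtain ⟨s₁, s₂, s₃, hs⟩ := hc₁
  obtain ⟨t₁, t₂, t₃, ht⟩ := hc₂
  obtain ⟨w₁, w₂, w₃, hw⟩ := hc₃
  -- The powers are peeled off one at a time: `c ≡ q₁ ^ n * s₁` modulo `(q₂ ^ (n + 1), q₃ ^ (n +
  -- 1))`, then `s₁ ≡ q₂ ^ n * u₂` modulo `(q₁, q₃ ^ (n + 1))`, then `u₂ ≡ q₃ ^ n * x₃` modulo `(q₁,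
  -- q₂)`.
  obtain ⟨c₂, c₃, hc⟩ := h₁.trd (c - q₁ ^ n * s₁) s₂ s₃ (by linear_combination hs)
  obtain ⟨u₂, u₃, hu⟩ := h₁'.trd (q₂ * s₁ - q₁ * t₁) (t₂ - q₂ * c₂) (t₃ - q₂ * c₃) (by
    linear_combination ht - q₂ * hc)
  obtain ⟨d₁, d₃, hd⟩ := h₂.trd (s₁ - q₂ ^ n * u₂) t₁ u₃ (by linear_combination hu)
  obtain ⟨v₂, v₃, hv⟩ := h₁'.trd (q₃ * q₂ ^ n * u₂ + q₃ * q₁ * d₁ - q₁ * w₁) (w₂ - q₃ * c₂)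
    (w₃ - q₃ * c₃ - q₁ ^ n * q₃ * d₃) (by
      linear_combination hw - q₃ * hc - q₁ ^ n * q₃ * hd)
  obtain ⟨x₁, x₃, hx⟩ := h₂'.trd (q₃ * u₂ - q₂ * v₂) (w₁ - q₃ * d₁) v₃ (by
    linear_combination hv)
  obtain ⟨y₁, y₂, hy⟩ := h₃.trd (u₂ - q₃ ^ n * x₃) x₁ v₂ (by linear_combination hx)
  exact ⟨x₃, d₁ + q₂ ^ n * y₁, c₂ + q₁ ^ n * y₂, c₃ + q₁ ^ n * d₃, by
    linear_combination hc + q₁ ^ n * hd + q₁ ^ n * q₂ ^ n * hy⟩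

end CohenMacaulayTools

/-! ### The resolution of the square of the ideal of minors. -/

namespace CohenMacaulayTools

variable {R : Type*} [CommRing R]

/-- Evaluation of the ternary quadratic form with coefficients `a` at `(f₁, f₂, f₃)`. -/
def quadraticEval (f₁ f₂ f₃ : R) : (Fin 6 → R) →ₗ[R] R where
  toFun a := a 0 * f₁ ^ 2 + a 1 * (f₁ * f₂) + a 2 * (f₁ * f₃) + a 3 * f₂ ^ 2 +
    a 4 * (f₂ * f₃) + a 5 * f₃ ^ 2
  map_add' a b := by simp only [Pi.add_apply]; ring
  map_smul' c a := by simp only [Pi.smul_apply, smul_eq_mul, RingHom.id_apply]; ring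

/-- The coefficients of the quadratic form `P U + Q V`, where `U` and `V` are the linear forms with
coefficients `u` and `v`, and `(P, Q)` is the pair of linear forms with coefficients `b`. -/
def linearFormsMul (u₁ u₂ u₃ v₁ v₂ v₃ : R) : (Fin 6 → R) →ₗ[R] Fin 6 → R where
  toFun b := ![b 0 * u₁ + b 3 * v₁, b 0 * u₂ + b 1 * u₁ + b 3 * v₂ + b 4 * v₁,
    b 0 * u₃ + b 2 * u₁ + b 3 * v₃ + b 5 * v₁, b 1 * u₂ + b 4 * v₂,
    b 1 * u₃ + b 2 * u₂ + b 4 * v₃ + b 5 * v₂, b 2 * u₃ + b 5 * v₃]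
  map_add' a b := by
    ext i; fin_cases i <;> simp <;> ring
  map_smul' c a := by
    ext i; fin_cases i <;> simp <;> ring

/-- The Koszul syzygy `(V, -U)` of the linear forms `U, V`. -/
def koszulSyzygy (u₁ u₂ u₃ v₁ v₂ v₃ : R) : R →ₗ[R] Fin 6 → R where
  toFun c := ![c * v₁, c * v₂, c * v₃, -(c * u₁), -(c * u₂), -(c * u₃)]
  map_add' a b := by
    ext i; fin_cases i <;> simp <;> ring
  map_smul' c a := by
    ext i; fin_cases i <;> simp <;> ring

variable {u₁ u₂ u₃ v₁ v₂ v₃ : R}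

theorem linearFormsMul_koszulSyzygy (c : R) :
    linearFormsMul u₁ u₂ u₃ v₁ v₂ v₃ (koszulSyzygy u₁ u₂ u₃ v₁ v₂ v₃ c) = 0 := by
  ext i; fin_cases i <;> simp [linearFormsMul, koszulSyzygy] <;> ring

theorem exists_koszulSyzygy_eq {w : R} (huv : RegularTriple u₁ v₁ w)
    (hf₂ : ∀ s, (u₃ * v₁ - u₁ * v₃) * s = 0 → s = 0)
    (hf₃ : ∀ s, (u₁ * v₂ - u₂ * v₁) * s = 0 → s = 0) {b : Fin 6 → R}
    (hb : linearFormsMul u₁ u₂ u₃ v₁ v₂ v₃ b = 0) :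
    ∃ c, koszulSyzygy u₁ u₂ u₃ v₁ v₂ v₃ c = b := by
  have h0 : b 0 * u₁ + b 3 * v₁ = 0 := congrFun hb 0
  have h1 : b 0 * u₂ + b 1 * u₁ + b 3 * v₂ + b 4 * v₁ = 0 := congrFun hb 1
  have h2 : b 0 * u₃ + b 2 * u₁ + b 3 * v₃ + b 5 * v₁ = 0 := congrFun hb 2
  have h3 : b 1 * u₂ + b 4 * v₂ = 0 := congrFun hb 3
  have h5 : b 2 * u₃ + b 5 * v₃ = 0 := congrFun hb 5
  have solve : ∀ p q, p * u₁ + q * v₁ = 0 → ∃ s, q = -(s * u₁) ∧ p = s * v₁ := fun p q h ↦ by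
    obtain ⟨s, hs⟩ := huv.snd q (-p) (by linear_combination h)
    refine ⟨-s, by rw [hs]; ring, sub_eq_zero.1 (huv.fst _ ?_)⟩
    linear_combination h - v₁ * hs
  -- The `T₁²` coefficient fixes the multiple `s` of `(V, -U)`. After subtracting it, the `T₁T₂` and
  -- `T₁T₃` coefficients leave errors `s₂` and `s₃`, killed by the minors `f₃` and `f₂` through the
  -- `T₂²` and `T₃²` coefficients.
  obtain ⟨s, h3s, h0s⟩ := solve _ _ h0
  obtain ⟨s₂, h4s, h1s⟩ := solve (b 1 - s * v₂) (b 4 + s * u₂) (by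
    linear_combination h1 - u₂ * h0s - v₂ * h3s)
  obtain ⟨s₃, h5s, h2s⟩ := solve (b 2 - s * v₃) (b 5 + s * u₃) (by
    linear_combination h2 - u₃ * h0s - v₃ * h3s)
  have hs₂ : s₂ = 0 := hf₃ s₂ (by linear_combination -h3 + u₂ * h1s + v₂ * h4s)
  have hs₃ : s₃ = 0 := hf₂ s₃ (by linear_combination h5 - u₃ * h2s - v₃ * h5s)
  subst hs₂ hs₃
  refine ⟨s, ?_⟩
  ext i
  fin_cases i <;> simp only [koszulSyzygy, LinearMap.coe_mk, AddHom.coe_mk]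
  · exact h0s.symm
  · change s * v₂ = b 1
    linear_combination -h1s
  · change s * v₃ = b 2
    linear_combination -h2s
  · exact h3s.symm
  · change -(s * u₂) = b 4
    linear_combination -h4s
  · change -(s * u₃) = b 5
    linear_combination -h5s

/-- Exactness at the Koszul syzygies modulo an element `x` dividing `u₁` and `v₃`. -/
theorem exists_eq_koszulSyzygy_add_smul {x w₁ w₂ : R} (hvu : RegularTriple x v₁ u₃)
    (hu₂ : RegularTriple x u₂ w₁) (hu₃ : RegularTriple x u₃ w₂) (hx₁ : x ∣ u₁) (hx₃ : x ∣ v₃)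
    {a b : Fin 6 → R} (hb : linearFormsMul u₁ u₂ u₃ v₁ v₂ v₃ b = x • a) :
    ∃ c b', b = koszulSyzygy u₁ u₂ u₃ v₁ v₂ v₃ c + x • b' := by
  obtain ⟨u₁, rfl⟩ := hx₁
  obtain ⟨v₃, rfl⟩ := hx₃
  have h0 : b 0 * (x * u₁) + b 3 * v₁ = x * a 0 := congrFun hb 0
  have h1 : b 0 * u₂ + b 1 * (x * u₁) + b 3 * v₂ + b 4 * v₁ = x * a 1 := congrFun hb 1
  have h2 : b 0 * u₃ + b 2 * (x * u₁) + b 3 * (x * v₃) + b 5 * v₁ = x * a 2 := congrFun hb 2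
  have h3 : b 1 * u₂ + b 4 * v₂ = x * a 3 := congrFun hb 3
  have h5 : b 2 * u₃ + b 5 * (x * v₃) = x * a 5 := congrFun hb 5
  obtain ⟨b₃, hb₃⟩ := hvu.snd (b 3) (a 0 - b 0 * u₁) (by linear_combination h0)
  obtain ⟨b₂, hb₂⟩ := hu₃.snd (b 2) (a 5 - b 5 * v₃) (by linear_combination h5)
  obtain ⟨b₀, s, hb₀⟩ := hvu.trd (b 0) (a 2 - b 2 * u₁ - b 3 * v₃) (-b 5) (by
    linear_combination h2)
  obtain ⟨b₅, hb₅⟩ := hvu.snd (b 5 + s * u₃) (a 2 - b 2 * u₁ - b 3 * v₃ - b₀ * u₃) (by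
    linear_combination h2 - u₃ * hb₀)
  obtain ⟨b₄, hb₄⟩ := hvu.snd (b 4 + s * u₂) (a 1 - b 1 * u₁ - b₃ * v₂ - b₀ * u₂) (by
    linear_combination h1 - u₂ * hb₀ - v₂ * hb₃)
  obtain ⟨b₁, hb₁⟩ := hu₂.snd (b 1 - s * v₂) (a 3 - b₄ * v₂) (by
    linear_combination h3 - v₂ * hb₄)
  refine ⟨s, ![b₀, b₁, b₂ - s * v₃, b₃ + s * u₁, b₄, b₅], ?_⟩
  ext i
  fin_cases i <;> simp [koszulSyzygy]
  · linear_combination hb₀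
  · linear_combination hb₁
  · linear_combination hb₂
  · linear_combination hb₃
  · linear_combination hb₄
  · linear_combination hb₅

/-- `x` is regular on the cokernel of `linearFormsMul`: a relation modulo `x` is a Koszul syzygy
plus a multiple of `x`, and the syzygy maps to zero. This removes the factor `u₁ ^ 2`, a power of
`x`, from the elimination argument. -/
theorem exists_linearFormsMul_eq_of_pow_smul {x w₁ w₂ : R} (hvu : RegularTriple x v₁ u₃)
    (hu₂ : RegularTriple x u₂ w₁) (hu₃ : RegularTriple x u₃ w₂) (hx₁ : x ∣ u₁) (hx₃ : x ∣ v₃)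
    (n : ℕ) {a : Fin 6 → R} (ha : ∃ b, linearFormsMul u₁ u₂ u₃ v₁ v₂ v₃ b = x ^ n • a) :
    ∃ b, linearFormsMul u₁ u₂ u₃ v₁ v₂ v₃ b = a := by
  induction n with
  | zero => simpa using ha
  | succ n ih =>
    obtain ⟨b, hb⟩ := ha
    rw [pow_succ', mul_smul] at hb
    obtain ⟨c, b', rfl⟩ := exists_eq_koszulSyzygy_add_smul hvu hu₂ hu₃ hx₁ hx₃ hb
    rw [map_add, linearFormsMul_koszulSyzygy, zero_add, map_smul] at hb
    refine ih ⟨b', funext fun i ↦ sub_eq_zero.1 (hvu.fst _ ?_)⟩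
    have := congrFun hb i
    simp only [Pi.smul_apply, smul_eq_mul] at this ⊢
    linear_combination this

/-- A quadratic form that vanishes at the maximal minors lies in `(U, V)` after multiplication
by `u₁ ^ 2`. -/
theorem exists_linearFormsMul_eq_sq_smul {w f₁ f₂ f₃ : R} (hf₁ : f₁ = u₂ * v₃ - u₃ * v₂)
    (hf₂ : f₂ = u₃ * v₁ - u₁ * v₃) (hf₃ : f₃ = u₁ * v₂ - u₂ * v₁)
    (hf : RegularTriple f₂ f₃ w) {a : Fin 6 → R} (ha : quadraticEval f₁ f₂ f₃ a = 0) :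
    ∃ b, linearFormsMul u₁ u₂ u₃ v₁ v₂ v₃ b = u₁ ^ 2 • a := by
  change a 0 * f₁ ^ 2 + a 1 * (f₁ * f₂) + a 2 * (f₁ * f₃) + a 3 * f₂ ^ 2 +
    a 4 * (f₂ * f₃) + a 5 * f₃ ^ 2 = 0 at ha
  -- Substituting `u₁T₁ = U - u₂T₂ - u₃T₃` in `u₁² a` leaves, modulo `U`, a binary form `g`
  -- vanishing at `(f₂, f₃)`. Regularity makes it `(f₂T₃ - f₃T₂)(mT₂ + lT₃)`, and `f₂T₃ - f₃T₂ = v₁U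
  -- - u₁V`.
  obtain ⟨g₂₂, hg₂₂⟩ : ∃ g, g = a 0 * u₂ ^ 2 - u₁ * u₂ * a 1 + u₁ ^ 2 * a 3 := ⟨_, rfl⟩
  obtain ⟨g₂₃, hg₂₃⟩ : ∃ g, g = 2 * a 0 * u₂ * u₃ - u₁ * (u₂ * a 2 + u₃ * a 1) + u₁ ^ 2 * a 4 :=
    ⟨_, rfl⟩
  obtain ⟨g₃₃, hg₃₃⟩ : ∃ g, g = a 0 * u₃ ^ 2 - u₁ * u₃ * a 2 + u₁ ^ 2 * a 5 := ⟨_, rfl⟩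
  have huf : u₁ * f₁ + u₂ * f₂ + u₃ * f₃ = 0 := by rw [hf₁, hf₂, hf₃]; ring
  have hg : g₂₂ * f₂ ^ 2 + g₂₃ * (f₂ * f₃) + g₃₃ * f₃ ^ 2 = 0 := by
    rw [hg₂₂, hg₂₃, hg₃₃]
    linear_combination u₁ ^ 2 * ha + (-a 0 * (u₁ * f₁ - u₂ * f₂ - u₃ * f₃) -
      u₁ * (a 1 * f₂ + a 2 * f₃)) * huf
  obtain ⟨t, ht⟩ := hf.snd (f₃ * g₃₃) (-(g₂₂ * f₂ + g₂₃ * f₃)) (by linear_combination hg)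
  obtain ⟨l, hl⟩ := hf.snd g₃₃ t ht
  obtain ⟨m, hm⟩ := hf.snd (g₂₃ + l * f₃) (-g₂₂) (by
    have : f₂ * (g₂₂ * f₂ + g₂₃ * f₃ + l * f₃ ^ 2) = 0 := by
      linear_combination hg - f₃ ^ 2 * hl
    linear_combination hf.fst _ this)
  have h22 : g₂₂ = -m * f₃ := by
    refine sub_eq_zero.1 (hf.fst _ (hf.fst _ ?_))
    linear_combination hg - f₃ ^ 2 * hl - f₂ * f₃ * hm
  refine ⟨![a 0 * u₁, u₁ * a 1 - a 0 * u₂ + v₁ * m, u₁ * a 2 - a 0 * u₃ + v₁ * l, 0, -(u₁ * m),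
    -(u₁ * l)], ?_⟩
  ext i
  fin_cases i <;> simp [linearFormsMul]
  · ring
  · ring
  · ring
  · linear_combination hg₂₂ - h22 + m * hf₃
  · linear_combination hg₂₃ - hm - m * hf₂ + l * hf₃
  · linear_combination hg₃₃ - hl - l * hf₂

theorem isExactComplex {x w₁ w₂ w₃ w₄ f₁ f₂ f₃ : R} (hf₁ : f₁ = u₂ * v₃ - u₃ * v₂)
    (hf₂ : f₂ = u₃ * v₁ - u₁ * v₃) (hf₃ : f₃ = u₁ * v₂ - u₂ * v₁) {n : ℕ} (hn : u₁ = x ^ n)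
    (hx₁ : x ∣ u₁) (hx₃ : x ∣ v₃) (hvu : RegularTriple x v₁ u₃) (hu₂ : RegularTriple x u₂ w₁)
    (hu₃ : RegularTriple x u₃ w₂) (huv : RegularTriple u₁ v₁ w₃)
    (hf₂₃ : RegularTriple f₂ f₃ w₄) (hf₃' : ∀ s, f₃ * s = 0 → s = 0) :
    IsExactComplex (quadraticEval f₁ f₂ f₃) (linearFormsMul u₁ u₂ u₃ v₁ v₂ v₃)
      (koszulSyzygy u₁ u₂ u₃ v₁ v₂ v₃) where
  g_h b := by
    rw [hf₁, hf₂, hf₃]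
    simp [quadraticEval, linearFormsMul]
    ring
  exists_h a ha := by
    obtain ⟨b, hb⟩ := exists_linearFormsMul_eq_sq_smul hf₁ hf₂ hf₃ hf₂₃ ha
    refine exists_linearFormsMul_eq_of_pow_smul hvu hu₂ hu₃ hx₁ hx₃ (n * 2) ⟨b, ?_⟩
    rw [hb, pow_mul, ← hn]
  h_k := linearFormsMul_koszulSyzygy
  exists_k b hb := exists_koszulSyzygy_eq huv (hf₂ ▸ hf₂₃.fst) (hf₃ ▸ hf₃') hb
  k_inj c hc := by
    have h : -(c * u₁) = 0 := congrFun hc 3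
    exact huv.fst c (by linear_combination -h)

end CohenMacaulayTools

/-! ### Symbolic powers as saturations. -/

namespace CohenMacaulayTools

open IsLocalRing

section SymbolicPower

variable {R : Type*} [CommRing R] {I : Ideal R} {n : ℕ}

theorem mem_comap_map_localization_iff {J p : Ideal R} [p.IsPrime] {r : R} :
    r ∈ (J.map (algebraMap R (Localization.AtPrime p))).comap
      (algebraMap R (Localization.AtPrime p)) ↔ ∃ s ∉ p, s * r ∈ J := by
  rw [Ideal.mem_comap, IsLocalization.algebraMap_mem_map_algebraMap_iff p.primeCompl]
  rfl

theorem mem_symbolicPower_iff {r : R} :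
    r ∈ symbolicPower I n ↔ ∀ p ∈ I.minimalPrimes, ∃ s ∉ p, s * r ∈ I ^ n := by
  simp only [symbolicPower, Submodule.mem_iInf]
  constructor
  · intro h p hp
    have := hp.1.1
    exact mem_comap_map_localization_iff.1 (h ⟨p, hp.1.1⟩ hp)
  · exact fun h p hp ↦ mem_comap_map_localization_iff.2 (h p.asIdeal hp)

/-- If `R / I` has dimension at most one, elements of a symbolic power of `I` are multiplied into
the ordinary power by a power of any given element of the maximal ideal. -/
theorem exists_pow_mul_mem_of_mem_symbolicPower [IsLocalRing R]
    (hI : ∀ p : Ideal R, p.IsPrime → I ≤ p → p ∈ I.minimalPrimes ∨ p = maximalIdeal R) {r t : R}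
    (hr : r ∈ symbolicPower I n) (ht : t ∈ maximalIdeal R) : ∃ k, t ^ k * r ∈ I ^ n := by
  by_contra! hcon
  have hrad : t ∉ ((I ^ n).colon {r}).radical := by
    rintro ⟨k, hk⟩
    exact hcon k (by simpa [Submodule.mem_colon_singleton] using hk)
  -- Some prime contains `Iⁿ : r` and avoids `t`. It contains `I`, but it is not minimal over `I`,
  -- since `r` is in the symbolic power, and not maximal, since `t` is outside it.
  rw [Ideal.radical_eq_sInf, Submodule.mem_sInf] at hrad
  push Not at hrad
  obtain ⟨p, ⟨hle, hp⟩, htp⟩ := hrad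
  have hIp : I ≤ p := by
    refine hp.le_of_pow_le (n := n) (le_trans (fun a ha ↦ ?_) hle)
    rw [Submodule.mem_colon_singleton]
    exact Ideal.mul_mem_right r _ ha
  rcases hI p hp hIp with hmin | rfl
  · obtain ⟨s, hs, hsr⟩ := mem_symbolicPower_iff.1 hr p hmin
    exact hs (hle (by simpa [Submodule.mem_colon_singleton] using hsr))
  · exact htp ht

theorem mem_symbolicPower_of_mem_colon {Q : Ideal R} (hQ : ∀ p ∈ I.minimalPrimes, ¬ Q ≤ p) {r : R}
    (hr : r ∈ (I ^ n).colon (Q : Set R)) : r ∈ symbolicPower I n := by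
  refine mem_symbolicPower_iff.2 fun p hp ↦ ?_
  obtain ⟨s, hs, hsp⟩ := SetLike.not_le_iff_exists.1 (hQ p hp)
  refine ⟨s, hsp, ?_⟩
  rw [mul_comm]
  exact Submodule.mem_colon.1 hr s hs

/-- The map `s ↦ s d` from `R` to the quotient is onto with kernel `Q`, which yields both claims at
once. -/
theorem symbolicPower_eq_colon_of_generator {Q : Ideal R} {d : R}
    (hQ : ∀ p ∈ I.minimalPrimes, ¬ Q ≤ p)
    (hgen : ∀ r ∈ symbolicPower I n, ∃ s, r - s * d ∈ I ^ n)
    (hd : ∀ s, s * d ∈ I ^ n ↔ s ∈ Q) :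
    symbolicPower I n = (I ^ n).colon (Q : Set R) ∧
      Nonempty (SymbolicPowerQuotient I n ≃ₗ[R] R ⧸ Q) := by
  have hle : (I ^ n).colon (Q : Set R) ≤ symbolicPower I n :=
    fun r hr ↦ mem_symbolicPower_of_mem_colon hQ hr
  have hdc : d ∈ (I ^ n).colon (Q : Set R) := Submodule.mem_colon.2 fun s hs ↦ by
    rw [smul_eq_mul, mul_comm]
    exact (hd s).2 hs
  refine ⟨le_antisymm (fun r hr ↦ ?_) hle, ?_⟩
  · obtain ⟨s, hs⟩ := hgen r hr
    have h1 : r - s * d ∈ (I ^ n).colon (Q : Set R) :=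
      Submodule.mem_colon.2 fun q _ ↦ Ideal.mul_mem_right q _ hs
    simpa using Ideal.add_mem _ h1 (Ideal.mul_mem_left _ s hdc)
  · let e : SymbolicPowerQuotient I n := Submodule.Quotient.mk ⟨d, hle hdc⟩
    have hker : LinearMap.ker (LinearMap.toSpanSingleton R _ e) = Q := by
      ext s
      rw [LinearMap.mem_ker, LinearMap.toSpanSingleton_apply, ← Submodule.Quotient.mk_smul,
        Submodule.Quotient.mk_eq_zero, ← hd]
      exact Iff.rfl
    have hsurj : Function.Surjective (LinearMap.toSpanSingleton R _ e) := fun r ↦ by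
      obtain ⟨⟨r, hr⟩, rfl⟩ := Submodule.Quotient.mk_surjective _ r
      obtain ⟨s, hs⟩ := hgen r hr
      refine ⟨s, ?_⟩
      rw [LinearMap.toSpanSingleton_apply, ← Submodule.Quotient.mk_smul, eq_comm,
        Submodule.Quotient.eq]
      exact hs
    exact ⟨((Submodule.quotEquivOfEq _ _ hker).symm.trans
      (LinearMap.quotKerEquivOfSurjective _ hsurj)).symm⟩

end SymbolicPower

/-! ### The ideal of minors of a two by three matrix. -/

section Minors

variable {R : Type*} [CommRing R]

theorem maximalMinorsIdeal_two_three (u₁ u₂ u₃ v₁ v₂ v₃ : R) :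
    maximalMinorsIdeal !![u₁, u₂, u₃; v₁, v₂, v₃] =
      Ideal.span {u₂ * v₃ - u₃ * v₂, u₃ * v₁ - u₁ * v₃, u₁ * v₂ - u₂ * v₁} := by
  refine le_antisymm (Ideal.span_le.2 ?_) (Ideal.span_le.2 ?_)
  · rintro _ ⟨e, rfl⟩
    have he : e 0 < e 1 := e.strictMono (by decide)
    simp only [SetLike.mem_coe, Matrix.det_fin_two, Matrix.submatrix_apply, id]
    generalize e 0 = i at he ⊢
    generalize e 1 = j at he ⊢
    have h1 : u₂ * v₃ - u₃ * v₂ ∈ Ideal.span {u₂ * v₃ - u₃ * v₂, u₃ * v₁ - u₁ * v₃,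
      u₁ * v₂ - u₂ * v₁} := Ideal.subset_span (by simp)
    have h2 : u₃ * v₁ - u₁ * v₃ ∈ Ideal.span {u₂ * v₃ - u₃ * v₂, u₃ * v₁ - u₁ * v₃,
      u₁ * v₂ - u₂ * v₁} := Ideal.subset_span (by simp)
    have h3 : u₁ * v₂ - u₂ * v₁ ∈ Ideal.span {u₂ * v₃ - u₃ * v₂, u₃ * v₁ - u₁ * v₃,
      u₁ * v₂ - u₂ * v₁} := Ideal.subset_span (by simp)
    fin_cases i <;> fin_cases j <;> simp at he ⊢
    · exact h3
    · simpa using neg_mem h2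
    · exact h1
  · have key : ∀ i j : Fin 3, i < j → !![u₁, u₂, u₃; v₁, v₂, v₃] 0 i *
        !![u₁, u₂, u₃; v₁, v₂, v₃] 1 j - !![u₁, u₂, u₃; v₁, v₂, v₃] 0 j *
        !![u₁, u₂, u₃; v₁, v₂, v₃] 1 i ∈ maximalMinorsIdeal !![u₁, u₂, u₃; v₁, v₂, v₃] := by
      intro i j hij
      have hmono : StrictMono ![i, j] := by
        intro a b hab
        fin_cases a <;> fin_cases b <;> simp_all
      exact Ideal.subset_span ⟨OrderEmbedding.ofStrictMono _ hmono, Matrix.det_fin_two _⟩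
    rintro f (rfl | rfl | rfl)
    · exact key 1 2 (by decide)
    · simpa using neg_mem (key 0 2 (by decide))
    · exact key 0 1 (by decide)

theorem mem_span_triple_iff {a b c r : R} :
    r ∈ Ideal.span {a, b, c} ↔ ∃ s₁ s₂ s₃, r = a * s₁ + b * s₂ + c * s₃ := by
  rw [Ideal.span, Submodule.mem_span_triple]
  constructor
  · rintro ⟨s, t, w, rfl⟩
    exact ⟨s, t, w, by simp only [smul_eq_mul]; ring⟩
  · rintro ⟨s, t, w, rfl⟩
    exact ⟨s, t, w, by simp only [smul_eq_mul]; ring⟩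

theorem mem_span_triple_sq_iff {f₁ f₂ f₃ r : R} :
    r ∈ Ideal.span {f₁, f₂, f₃} ^ 2 ↔ ∃ a, quadraticEval f₁ f₂ f₃ a = r := by
  constructor
  · have hle : Ideal.span {f₁, f₂, f₃} ^ 2 ≤ LinearMap.range (quadraticEval f₁ f₂ f₃) := by
      rw [sq, Ideal.mul_le]
      intro a ha b hb
      obtain ⟨a₁, a₂, a₃, rfl⟩ := mem_span_triple_iff.1 ha
      obtain ⟨b₁, b₂, b₃, rfl⟩ := mem_span_triple_iff.1 hb
      refine ⟨![a₁ * b₁, a₁ * b₂ + a₂ * b₁, a₁ * b₃ + a₃ * b₁, a₂ * b₂, a₂ * b₃ + a₃ * b₂,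
        a₃ * b₃], ?_⟩
      simp [quadraticEval]
      ring
    exact fun hr ↦ hle hr
  · rintro ⟨a, rfl⟩
    have h1 : f₁ ∈ Ideal.span {f₁, f₂, f₃} := Ideal.subset_span (by simp)
    have h2 : f₂ ∈ Ideal.span {f₁, f₂, f₃} := Ideal.subset_span (by simp)
    have h3 : f₃ ∈ Ideal.span {f₁, f₂, f₃} := Ideal.subset_span (by simp)
    change a 0 * f₁ ^ 2 + a 1 * (f₁ * f₂) + a 2 * (f₁ * f₃) + a 3 * f₂ ^ 2 +
      a 4 * (f₂ * f₃) + a 5 * f₃ ^ 2 ∈ _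
    simp only [sq]
    refine add_mem (add_mem (add_mem (add_mem (add_mem ?_ ?_) ?_) ?_) ?_) ?_ <;>
      exact Ideal.mul_mem_left _ _ (Ideal.mul_mem_mul (by assumption) (by assumption))

variable {u₁ u₂ u₃ v₁ v₂ v₃ : R}

/-- An element `x` dividing `u₁` and `v₃` is regular modulo the maximal minors. -/
theorem mem_minors_of_mul_mem {x w : R} (hx₁ : x ∣ u₁) (hx₃ : x ∣ v₃)
    (h₁ : RegularTriple x u₃ (u₂ * v₁)) (h₂ : RegularTriple x v₁ v₂)
    (h₃ : RegularTriple x u₃ w) {r : R}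
    (hr : x * r ∈ Ideal.span {u₂ * v₃ - u₃ * v₂, u₃ * v₁ - u₁ * v₃, u₁ * v₂ - u₂ * v₁}) :
    r ∈ Ideal.span {u₂ * v₃ - u₃ * v₂, u₃ * v₁ - u₁ * v₃, u₁ * v₂ - u₂ * v₁} := by
  obtain ⟨u₁, rfl⟩ := hx₁
  obtain ⟨v₃, rfl⟩ := hx₃
  rw [mem_span_triple_iff] at hr ⊢
  obtain ⟨e₁, e₂, e₃, he⟩ := hr
  -- Modulo `x` the minors become `-u₃v₂, u₃v₁, -u₂v₁`, and the relation `e` on them is `s` times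
  -- the first row plus `t` times the second. Both rows lift to true relations, so subtracting them
  -- leaves `e` divisible by `x`.
  obtain ⟨c, hc⟩ : ∃ c, c = e₁ * u₂ * v₃ - x * (e₂ * u₁ * v₃) + e₃ * u₁ * v₂ - r := ⟨_, rfl⟩
  obtain ⟨a₃, s, ha₃⟩ := h₁.trd e₃ c (e₂ * v₁ - e₁ * v₂) (by linear_combination he - x * hc)
  obtain ⟨b, hb⟩ := h₃.snd (e₁ * v₂ - e₂ * v₁ + s * u₂ * v₁) (c - a₃ * u₂ * v₁) (by
    linear_combination he - x * hc - u₂ * v₁ * ha₃)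
  obtain ⟨a₁, t, ha₁⟩ := h₂.trd e₁ b (e₂ - s * u₂) (by linear_combination hb)
  obtain ⟨a₂, ha₂⟩ := h₂.snd (e₂ - s * u₂ - t * v₂) (a₁ * v₂ - b) (by
    linear_combination -hb + v₂ * ha₁)
  refine ⟨a₁ - s * u₁, a₂, a₃ - t * v₃, sub_eq_zero.1 (h₁.fst _ ?_)⟩
  linear_combination he + (u₂ * (x * v₃) - u₃ * v₂) * ha₁ + (u₃ * v₁ - x * u₁ * (x * v₃)) * ha₂ +
    (x * u₁ * v₂ - u₂ * v₁) * ha₃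

end Minors

end CohenMacaulayTools

/-! ### The main theorem. -/

open CohenMacaulayTools IsLocalRing in
theorem theorem4p4 {R : Type*} [CommRing R] [IsLocalRing R] [IsNoetherianRing R]
    (hCM : IsCohenMacaulayLocal R) (hdim : ringKrullDim R = 3)
    (x y z : R) (hxyz : IsSystemOfParameters ![x, y, z])
    (α β γ α' β' γ' : ℕ) (hα : 0 < α) (hβ : 0 < β) (hγ : 0 < γ)
    (hα' : 0 < α') (hβ' : 0 < β') (hγ' : 0 < γ')
    (I Q : Ideal R)
    (hI : I = maximalMinorsIdeal !![x ^ α, y ^ β, z ^ γ; y ^ β', z ^ γ', x ^ α'])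
    (hQ : Q = Ideal.span {x ^ min α α', y ^ min β β', z ^ min γ γ'}) :
    symbolicPower I 2 = (I ^ 2).colon (Q : Set R) ∧
      Nonempty (SymbolicPowerQuotient I 2 ≃ₗ[R] R ⧸ Q) := by
  have hmax : ∀ P : Ideal R, P.IsPrime → x ∈ P → y ∈ P → z ∈ P → P = maximalIdeal R := by
    intro P hP hx hy hz
    refine le_antisymm (le_maximalIdeal hP.ne_top) ?_
    rw [← hxyz.2, hP.radical_le_iff, Ideal.span_le]
    rintro _ ⟨i, rfl⟩
    fin_cases i
    exacts [hx, hy, hz]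
  have hmem : ∀ i, ![x, y, z] i ∈ maximalIdeal R := fun i ↦ by
    rw [← hxyz.2]
    exact Ideal.le_radical (Ideal.subset_span ⟨i, rfl⟩)
  have hxm : x ∈ maximalIdeal R := hmem 0
  have hym : y ∈ maximalIdeal R := hmem 1
  have hzm : z ∈ maximalIdeal R := hmem 2
  have triple : ∀ {a b c : R}, a ∈ maximalIdeal R → b ∈ maximalIdeal R → c ∈ maximalIdeal R →
      (∀ P : Ideal R, P.IsPrime → a ∈ P → b ∈ P → c ∈ P → x ∈ P ∧ y ∈ P ∧ z ∈ P) →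
      RegularTriple a b c := by
    intro a b c ha hb hc h
    refine (hCM.isRegular [a, b, c] (by rw [hdim]; rfl)
      (by simpa using ⟨ha, hb, hc⟩)
      fun P hP hP' ↦ ?_).toIsWeaklyRegular.regularTriple
    simp only [List.mem_cons, List.not_mem_nil, or_false, forall_eq_or_imp, forall_eq] at hP'
    obtain ⟨h1, h2, h3⟩ := h P hP hP'.1 hP'.2.1 hP'.2.2
    exact hmax P hP h1 h2 h3
  have hpm : ∀ {t : R} {i : ℕ}, 0 < i → t ∈ maximalIdeal R → t ^ i ∈ maximalIdeal R :=
    fun hi ht ↦ Ideal.pow_mem_of_mem _ ht _ hi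
  have hα'' : 0 < min α α' := lt_min hα hα'
  have hβ'' : 0 < min β β' := lt_min hβ hβ'
  have hγ'' : 0 < min γ γ' := lt_min hγ hγ'
  obtain ⟨f₁, hf₁⟩ : ∃ f, f = y ^ β * x ^ α' - z ^ γ * z ^ γ' := ⟨_, rfl⟩
  obtain ⟨f₂, hf₂⟩ : ∃ f, f = z ^ γ * y ^ β' - x ^ α * x ^ α' := ⟨_, rfl⟩
  obtain ⟨f₃, hf₃⟩ : ∃ f, f = x ^ α * z ^ γ' - y ^ β * y ^ β' := ⟨_, rfl⟩
  have hxdvd : x ∣ x ^ α := dvd_pow_self x hα.ne'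
  have hxdvd' : x ∣ x ^ α' := dvd_pow_self x hα'.ne'
  have hfm₂ : f₂ ∈ maximalIdeal R := by
    rw [hf₂]
    exact sub_mem (Ideal.mul_mem_right _ _ (hpm hγ hzm)) (Ideal.mul_mem_right _ _ (hpm hα hxm))
  have hfm₃ : f₃ ∈ maximalIdeal R := by
    rw [hf₃]
    exact sub_mem (Ideal.mul_mem_right _ _ (hpm hα hxm)) (Ideal.mul_mem_right _ _ (hpm hβ hym))
  have hz₁ : ∀ P : Ideal R, P.IsPrime → f₁ ∈ P → x ∈ P → z ∈ P := by
    intro P hP h1 hx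
    have h2 : z ^ γ * z ^ γ' ∈ P := by
      have : z ^ γ * z ^ γ' = y ^ β * x ^ α' - f₁ := by rw [hf₁]; ring
      rw [this]
      exact sub_mem (Ideal.mul_mem_left _ _ (Ideal.pow_mem_of_mem _ hx _ hα')) h1
    exact (hP.mem_or_mem h2).elim (hP.mem_of_pow_mem _) (hP.mem_of_pow_mem _)
  have hx₂ : ∀ P : Ideal R, P.IsPrime → f₂ ∈ P → z ∈ P → x ∈ P := by
    intro P hP h1 hz
    have h2 : x ^ α * x ^ α' ∈ P := by
      have : x ^ α * x ^ α' = z ^ γ * y ^ β' - f₂ := by rw [hf₂]; ring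
      rw [this]
      exact sub_mem (Ideal.mul_mem_right _ _ (Ideal.pow_mem_of_mem _ hz _ hγ)) h1
    exact (hP.mem_or_mem h2).elim (hP.mem_of_pow_mem _) (hP.mem_of_pow_mem _)
  have hy₃ : ∀ P : Ideal R, P.IsPrime → f₃ ∈ P → x ∈ P → y ∈ P := by
    intro P hP h1 hx
    have h2 : y ^ β * y ^ β' ∈ P := by
      have : y ^ β * y ^ β' = x ^ α * z ^ γ' - f₃ := by rw [hf₃]; ring
      rw [this]
      exact sub_mem (Ideal.mul_mem_right _ _ (Ideal.pow_mem_of_mem _ hx _ hα)) h1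
    exact (hP.mem_or_mem h2).elim (hP.mem_of_pow_mem _) (hP.mem_of_pow_mem _)
  have hI' : I = Ideal.span {f₁, f₂, f₃} := by
    rw [hI, maximalMinorsIdeal_two_three, hf₁, hf₂, hf₃]
  have hf₁I : f₁ ∈ I := hI' ▸ Ideal.subset_span (by simp)
  have hf₃I : f₃ ∈ I := hI' ▸ Ideal.subset_span (by simp)
  have hIx : ∀ P : Ideal R, P.IsPrime → I ≤ P → x ∈ P → P = maximalIdeal R := fun P hP hle hx ↦
    hmax P hP hx (hy₃ P hP (hle hf₃I) hx) (hz₁ P hP (hle hf₁I) hx)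
  -- permuted powers of the parameters
  have hxyz' : ∀ {i j k : ℕ}, 0 < i → 0 < j → 0 < k → RegularTriple (x ^ i) (y ^ j) (z ^ k) :=
    fun hi hj hk ↦ triple (hpm hi hxm) (hpm hj hym) (hpm hk hzm) fun P hP h1 h2 h3 ↦
      ⟨hP.mem_of_pow_mem _ h1, hP.mem_of_pow_mem _ h2, hP.mem_of_pow_mem _ h3⟩
  have hxzy' : ∀ {i j k : ℕ}, 0 < i → 0 < j → 0 < k → RegularTriple (x ^ i) (z ^ k) (y ^ j) :=
    fun hi hj hk ↦ triple (hpm hi hxm) (hpm hk hzm) (hpm hj hym) fun P hP h1 h2 h3 ↦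
      ⟨hP.mem_of_pow_mem _ h1, hP.mem_of_pow_mem _ h3, hP.mem_of_pow_mem _ h2⟩
  have hyzx' : ∀ {i j k : ℕ}, 0 < i → 0 < j → 0 < k → RegularTriple (y ^ j) (z ^ k) (x ^ i) :=
    fun hi hj hk ↦ triple (hpm hj hym) (hpm hk hzm) (hpm hi hxm) fun P hP h1 h2 h3 ↦
      ⟨hP.mem_of_pow_mem _ h3, hP.mem_of_pow_mem _ h1, hP.mem_of_pow_mem _ h2⟩
  have hE : IsExactComplex (quadraticEval f₁ f₂ f₃)
      (linearFormsMul (x ^ α) (y ^ β) (z ^ γ) (y ^ β') (z ^ γ') (x ^ α'))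
      (koszulSyzygy (x ^ α) (y ^ β) (z ^ γ) (y ^ β') (z ^ γ') (x ^ α')) := by
    -- The `wᵢ` only complete a regular pair to a system of parameters.
    refine isExactComplex (x := x) (w₁ := z) (w₂ := y) (w₃ := z) (w₄ := z) hf₁ hf₂ hf₃ rfl
      hxdvd hxdvd' ?_ ?_ ?_ ?_ ?_ ?_
    · simpa using hxyz' one_pos hβ' hγ
    · simpa using hxyz' one_pos hβ one_pos
    · simpa using hxzy' one_pos one_pos hγ
    · simpa using hxyz' hα hβ' one_pos
    · exact triple hfm₂ hfm₃ hzm fun P hP h1 h2 h3 ↦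
        ⟨hx₂ P hP h1 h3, hy₃ P hP h2 (hx₂ P hP h1 h3), h3⟩
    · exact (triple hfm₃ hxm hzm fun P hP h1 h2 h3 ↦ ⟨h2, hy₃ P hP h1 h2, h3⟩).fst
  -- primes containing `I`
  have hdimI : ∀ p : Ideal R, p.IsPrime → I ≤ p → p ∈ I.minimalPrimes ∨ p = maximalIdeal R := by
    intro p hp hle
    by_contra! hcon
    obtain ⟨p₀, hp₀, hp₀p⟩ := Ideal.exists_minimalPrimes_le hle
    obtain ⟨s, hs, hs₀⟩ := SetLike.not_le_iff_exists.1 fun h : p ≤ p₀ ↦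
      hcon.1 (le_antisymm h hp₀p ▸ hp₀)
    obtain ⟨t, ht, htp⟩ := SetLike.not_le_iff_exists.1 fun h : maximalIdeal R ≤ p ↦
      hcon.2 (le_antisymm (le_maximalIdeal hp.ne_top) h)
    -- A chain `p₀ < p < maximalIdeal R` would force `dim R ⧸ p₀ ≥ 2`, whereas `x` alone cuts
    -- `V(p₀)` to the closed point.
    have h1 := ringKrullDim_quotient_le_length hp₀.1.1 [x] (by simpa using hxm)
      fun P hP hle' hxP ↦ hIx P hP (hp₀.1.2.trans hle') (by simpa using hxP)
    have h2 := ringKrullDim_quotient_succ_le_of_lt hp₀.1.1 hp₀p hs hs₀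
    have h3 := ringKrullDim_quotient_succ_le_of_lt hp (le_maximalIdeal hp.ne_top) ht htp
    have h4 : (0 : WithBot ℕ∞) ≤ ringKrullDim (R ⧸ maximalIdeal R) :=
      ringKrullDim_nonneg_of_nontrivial
    have h5 : (0 : WithBot ℕ∞) + 1 + 1 ≤ ([x] : List R).length :=
      (add_le_add_left ((add_le_add_left h4 1).trans h3) 1).trans (h2.trans h1)
    have h6 : (2 : ℕ) ≤ 1 := by exact_mod_cast h5
    omega
  have hmin : maximalIdeal R ∉ I.minimalPrimes := by
    intro hm
    have hrad : x ∈ I.radical := by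
      rw [Ideal.radical_eq_sInf, Submodule.mem_sInf]
      rintro P ⟨hle, hP⟩
      exact hm.2 ⟨hP, hle⟩ (le_maximalIdeal hP.ne_top) hxm
    obtain ⟨k, hk⟩ := hrad
    have hreg : ∀ r, x * r ∈ I → r ∈ I := by
      intro r hr
      rw [hI, maximalMinorsIdeal_two_three] at hr ⊢
      refine mem_minors_of_mul_mem hxdvd hxdvd' (w := y) ?_ ?_ ?_ hr
      · rw [← pow_add]
        simpa using hxzy' one_pos (Nat.add_pos_left hβ β') hγ
      · simpa using hxyz' one_pos hβ' hγ'
      · simpa using hxzy' one_pos one_pos hγ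
    have hone : (1 : R) ∈ I := by
      induction k with
      | zero => simpa using hk
      | succ k ih => exact ih (hreg _ (by rwa [← pow_succ']))
    exact hm.1.1.ne_top ((Ideal.eq_top_iff_one _).2 (hm.1.2 hone))
  have hQmin : ∀ p ∈ I.minimalPrimes, ¬ Q ≤ p := by
    intro p hp hle
    have hxp : x ∈ p := hp.1.1.mem_of_pow_mem (min α α') (hle (hQ ▸ Ideal.subset_span (by simp)))
    exact hmin (hIx p hp.1.1 hp.1.2 hxp ▸ hp)
  -- the generator of the symbolic power
  have hq := hxyz' hα'' hβ'' hγ''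
  have hIsq : ∀ r, r ∈ I ^ 2 ↔ ∃ a, quadraticEval f₁ f₂ f₃ a = r := fun r ↦ by
    rw [hI', mem_span_triple_sq_iff]
  obtain ⟨d, hd⟩ := hE.exists_koszulLift_one hq fun i ↦ by
    have h1 : ∀ t : R, ∃ s₁ s₂ s₃, x ^ min α α' * t =
        x ^ min α α' * s₁ + y ^ min β β' * s₂ + z ^ min γ γ' * s₃ := fun t ↦ ⟨t, 0, 0, by ring⟩
    have h2 : ∀ t : R, ∃ s₁ s₂ s₃, y ^ min β β' * t =
        x ^ min α α' * s₁ + y ^ min β β' * s₂ + z ^ min γ γ' * s₃ := fun t ↦ ⟨0, t, 0, by ring⟩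
    have h3 : ∀ t : R, ∃ s₁ s₂ s₃, z ^ min γ γ' * t =
        x ^ min α α' * s₁ + y ^ min β β' * s₂ + z ^ min γ γ' * s₃ := fun t ↦ ⟨0, 0, t, by ring⟩
    fin_cases i <;> simp only [koszulSyzygy, LinearMap.coe_mk, AddHom.coe_mk, one_mul]
    · obtain ⟨t, ht⟩ := pow_dvd_pow y (min_le_right β β')
      simpa [ht] using h2 t
    · obtain ⟨t, ht⟩ := pow_dvd_pow z (min_le_right γ γ')
      simpa [ht] using h3 t
    · obtain ⟨t, ht⟩ := pow_dvd_pow x (min_le_right α α')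
      simpa [ht] using h1 t
    · obtain ⟨t, ht⟩ := pow_dvd_pow x (min_le_left α α')
      simpa [ht] using h1 (-t)
    · obtain ⟨t, ht⟩ := pow_dvd_pow y (min_le_left β β')
      simpa [ht] using h2 (-t)
    · obtain ⟨t, ht⟩ := pow_dvd_pow z (min_le_left γ γ')
      simpa [ht] using h3 (-t)
  refine symbolicPower_eq_colon_of_generator (d := d) hQmin (fun r hr ↦ ?_) fun s ↦ ?_
  · obtain ⟨k₁, hk₁⟩ := exists_pow_mul_mem_of_mem_symbolicPower hdimI hr (hpm hα'' hxm)
    obtain ⟨k₂, hk₂⟩ := exists_pow_mul_mem_of_mem_symbolicPower hdimI hr (hpm hβ'' hym)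
    obtain ⟨k₃, hk₃⟩ := exists_pow_mul_mem_of_mem_symbolicPower hdimI hr (hpm hγ'' hzm)
    have hup : ∀ {t : R} {k l : ℕ}, k ≤ l → t ^ k * r ∈ I ^ 2 → ∃ a, t ^ l * r =
        quadraticEval f₁ f₂ f₃ a := fun {t k l} hkl h ↦ by
      obtain ⟨a, ha⟩ := (hIsq (t ^ l * r)).1 (by
        rw [← Nat.sub_add_cancel hkl, pow_add, mul_assoc]
        exact Ideal.mul_mem_left _ _ h)
      exact ⟨a, ha.symm⟩
    -- `0 < n` keeps the `n`-th powers of the parameters in the maximal ideal.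
    obtain ⟨n, hn, hn₁, hn₂, hn₃⟩ : ∃ n, 0 < n ∧ k₁ ≤ n + 1 ∧ k₂ ≤ n + 1 ∧ k₃ ≤ n + 1 :=
      ⟨k₁ + k₂ + k₃ + 1, by omega, by omega, by omega, by omega⟩
    obtain ⟨a₁, ha₁⟩ := hup hn₁ hk₁
    obtain ⟨a₂, ha₂⟩ := hup hn₂ hk₂
    obtain ⟨a₃, ha₃⟩ := hup hn₃ hk₃
    obtain ⟨c, hc⟩ := hE.exists_koszulLift ha₁ ha₂ ha₃
    have hneg : ∀ {t p₁ p₂ p₃ : R}, (∃ s₁ s₂ s₃, -t * c = p₁ * s₁ + p₂ * s₂ + p₃ * s₃) →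
        ∃ s₁ s₂ s₃, t * c = p₁ * s₁ + p₂ * s₂ + p₃ * s₃ := by
      rintro t p₁ p₂ p₃ ⟨s₁, s₂, s₃, hs⟩
      exact ⟨-s₁, -s₂, -s₃, by linear_combination -hs⟩
    have hc0 := hc.exists_mul_eq 0
    have hc1 := hc.exists_mul_eq 1
    have hc2 := hc.exists_mul_eq 2
    have hc3 := hc.exists_mul_eq 3
    have hc4 := hc.exists_mul_eq 4
    have hc5 := hc.exists_mul_eq 5
    simp only [koszulSyzygy, LinearMap.coe_mk, AddHom.coe_mk, one_mul] at hc0 hc1 hc2 hc3 hc4 hc5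
    have hn1 : 0 < n + 1 := n.succ_pos
    obtain ⟨s, s₁, s₂, s₃, hs⟩ := exists_eq_of_mul_mem_pow (n := n) (c := c)
      (q₁ := x ^ min α α') (q₂ := y ^ min β β') (q₃ := z ^ min γ γ')
      (by simp only [← pow_mul]; exact hyzx' hα'' (Nat.mul_pos hβ'' hn1) (Nat.mul_pos hγ'' hn1))
      (by
        simp only [← pow_mul]
        exact hyzx' (Nat.mul_pos hα'' hn) (Nat.mul_pos hβ'' hn1) (Nat.mul_pos hγ'' hn1))
      (by simp only [← pow_mul]; exact hxzy' hα'' hβ'' (Nat.mul_pos hγ'' hn1))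
      (by
        simp only [← pow_mul]
        exact hxzy' hα'' (Nat.mul_pos hβ'' hn) (Nat.mul_pos hγ'' hn1))
      hq
      -- Each minimum is attained, so each generator of `Q` is, up to sign, an entry of the Koszul
      -- syzygy.
      (by
        rcases min_choice α α' with h | h <;> rw [h] at hc2 hc3 ⊢
        exacts [hneg hc3, hc2])
      (by
        rcases min_choice β β' with h | h <;> rw [h] at hc0 hc4 ⊢
        exacts [hneg hc4, hc0])
      (by
        rcases min_choice γ γ' with h | h <;> rw [h] at hc1 hc5 ⊢
        exacts [hneg hc5, hc1])
    -- Relative to the `(n + 1)`-st powers, `d` has class $(q_1q_2q_3)^n$, so `r - s * d` has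
    -- trivial class.
    have hd' := hd.scale ((x ^ min α α') ^ n) ((y ^ min β β') ^ n) ((z ^ min γ γ') ^ n)
    simp only [← pow_succ, mul_one] at hd'
    have hfin := hc.sub_mul s hd'
    rw [hs] at hfin
    refine ⟨s, (hIsq _).2 (hE.mem_range_of_koszulLift ?_ hfin)⟩
    simp only [← pow_mul]
    exact hxyz' (Nat.mul_pos hα'' hn1) (Nat.mul_pos hβ'' hn1) (Nat.mul_pos hγ'' hn1)
  · rw [hIsq, hQ, mem_span_triple_iff]
    constructor
    · rintro ⟨a, ha⟩
      simpa using hE.exists_eq_of_koszulLift ha (hd.mul s)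
    · rintro ⟨s₁, s₂, s₃, rfl⟩
      have := hd.mul (x ^ min α α' * s₁ + y ^ min β β' * s₂ + z ^ min γ γ' * s₃)
      rw [mul_one] at this
      exact hE.mem_range_of_koszulLift hq this
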